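/- Let $a:[0,1]\to\mathbb R$ be continuous with $a(0)=0$ and $a>0$ on $(0,1]$, and assume that for some $K\in(0,2)$ the function $x\mapsto x^K/a(x)$ is nondecreasing near $x=0$. Let $L^2_{1/a}(0,1)=\{u\in L^2(0,1):\int_0^1 u^2/a\,dx<\infty\}$ with norm $\|u\|^2_{L^2_{1/a}}=\int_0^1 u^2/a\,dx$, let $H^2_{1/a}(0,1)=L^2_{1/a}(0,1)\cap H^2_0(0,1)$ with norm $\|u\|^2_{L^2_{1/a}}+\|u'\|_{L^2}^2+\|u''\|_{L^2}^2$ (squared), and let $\mathcal H_0=H^2_{1/a}(0,1)\times L^2_{1/a}(0,1)$. Define $Au=au''''$ on $D(A)=\{u\in H^2_{1/a}(0,1): au''''\in L^2_{1/a}(0,1)\}$ and $\mathcal A(u,v)=(v,-Au)$ on $D(\mathcal A)=D(A)\times H^2_{1/a}(0,1)$. For $(y_0,y_1)\in\mathcal H_0$, a mild solution of $$\begin{cases} y_{tt}+a\,y_{xxxx}=0, & (t,x)\in(0,\infty)\times(0,1),\\ y(t,0)=y(t,1)=y_x(t,0)=y_x(t,1)=0, & t>0,\\ y(0,x)=y_0(x),\quad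 y_t(0,x)=y_1(x), & x\in(0,1),\end{cases}$$ is a function $y\in C^1([0,\infty);L^2_{1/a}(0,1))\cap C([0,\infty);H^2_{1/a}(0,1))$ such that $\mathcal U=(y,y_t)$ is a mild solution of $\dot{\mathcal U}=\mathcal A\,\mathcal U$, $\mathcal U(0)=(y_0,y_1)$, that is, $\mathcal U\in C([0,\infty);\mathcal H_0)$ and, for all $t\ge 0$, $\int_0^t\mathcal U(s)\,ds\in D(\mathcal A)$ and $\mathcal U(t)=(y_0,y_1)+\mathcal A\int_0^t\mathcal U(s)\,ds$. Then for every $(y_0,y_1)\in\mathcal H_0$ and every such mild solution $y$, the energy $$E_y(t)=\frac12\int_0^1\Bigl(\frac{y_t^2(t,x)}{a(x)}+y_{xx}^2(t,x)\Bigr)dx$$ is constant in time: $E_y(t)=E_y(0)$ for all $t\ge 0$. -/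

import Mathlib

open MeasureTheory Set
open scoped ENNReal ContDiff

namespace DegenerateBeam

noncomputable section

/-- The standing hypothesis on the coefficient: `a` is continuous on `[0,1]`, `a 0 = 0`, `a > 0` on
`(0,1]`, and for some `K ∈ (0,2)` the function `x ↦ x ^ K / a x` is nondecreasing near `0`. -/
structure IsDegenerateCoeff (a : ℝ → ℝ) : Prop where
  continuousOn : ContinuousOn a (Icc 0 1)
  zero : a 0 = 0
  pos : ∀ x ∈ Ioc (0 : ℝ) 1, 0 < a x
  mono : ∃ K ∈ Ioo (0 : ℝ) 2, ∃ δ ∈ Ioc (0 : ℝ) 1, MonotoneOn (fun x => x ^ K / a x) (Ioc 0 δ)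

/-- Lebesgue measure on `(0,1)`. -/
abbrev unitMeasure : Measure ℝ := volume.restrict (Ioo 0 1)

/-- The measure `dx / a` on `(0,1)`. -/
def weightedMeasure (a : ℝ → ℝ) : Measure ℝ :=
  unitMeasure.withDensity fun x => ENNReal.ofReal (1 / a x)

/-- The space `L²(0,1)`. -/
abbrev L2 : Type := Lp ℝ 2 unitMeasure

/-- The space `L²_{1/a}(0,1)` with norm `(∫₀¹ u² / a dx)^{1/2}`. For `a` continuous on `[0,1]` and
positive on `(0,1]` null sets are the Lebesgue null sets of `(0,1)`, and, `a` being bounded,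
`L²_{1/a}(0,1) ⊆ L²(0,1)`. -/
abbrev L2w (a : ℝ → ℝ) : Type := Lp ℝ 2 (weightedMeasure a)

/-- `φ ∈ C_c^∞(0,1)`. -/
structure IsTestFunction (φ : ℝ → ℝ) : Prop where
  smooth : ContDiff ℝ ∞ φ
  compact : HasCompactSupport φ
  support : tsupport φ ⊆ Ioo 0 1

/-- `g` is the weak derivative of `f` on `(0,1)`. -/
def HasWeakDeriv (f g : ℝ → ℝ) : Prop :=
  ∀ φ : ℝ → ℝ, IsTestFunction φ →
    ∫ x in Ioo (0 : ℝ) 1, f x * deriv φ x = - ∫ x in Ioo (0 : ℝ) 1, g x * φ x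

/-- The continuous representative of `f` on `[0,1]` exists and vanishes at `0` and `1`. -/
def VanishesAtEnds (f : ℝ → ℝ) : Prop :=
  ∃ c : ℝ → ℝ, ContinuousOn c (Icc 0 1) ∧ c =ᵐ[unitMeasure] f ∧ c 0 = 0 ∧ c 1 = 0

/-- `f ∈ H²₀(0,1)`, with weak derivatives `f' = g` and `f'' = h`. -/
structure IsH20 (f g h : ℝ → ℝ) : Prop where
  memLp : MemLp f 2 unitMeasure
  memLp_deriv : MemLp g 2 unitMeasure
  memLp_deriv_deriv : MemLp h 2 unitMeasure
  weakDeriv : HasWeakDeriv f g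
  weakDeriv_deriv : HasWeakDeriv g h
  vanishes : VanishesAtEnds f
  vanishes_deriv : VanishesAtEnds g

theorem integrable_mul_of_memLp {f ψ : ℝ → ℝ} (hf : MemLp f 2 unitMeasure)
    (hψ : Continuous ψ) (hc : HasCompactSupport ψ) :
    Integrable (fun x => f x * ψ x) unitMeasure :=
  MemLp.integrable_mul hf
    (((hψ.memLp_of_hasCompactSupport hc (p := 2) (μ := volume))).restrict (Ioo 0 1))

theorem IsTestFunction.integrable_mul {f φ : ℝ → ℝ} (hφ : IsTestFunction φ)
    (hf : MemLp f 2 unitMeasure) : Integrable (fun x => f x * φ x) unitMeasure :=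
  integrable_mul_of_memLp hf hφ.smooth.continuous hφ.compact

theorem IsTestFunction.integrable_mul_deriv {f φ : ℝ → ℝ} (hφ : IsTestFunction φ)
    (hf : MemLp f 2 unitMeasure) : Integrable (fun x => f x * deriv φ x) unitMeasure :=
  integrable_mul_of_memLp hf (hφ.smooth.continuous_deriv (by simp)) hφ.compact.deriv

theorem HasWeakDeriv.add {f g f' g' : ℝ → ℝ} (hf : MemLp f 2 unitMeasure)
    (hg : MemLp g 2 unitMeasure) (hf' : MemLp f' 2 unitMeasure) (hg' : MemLp g' 2 unitMeasure)
    (h : HasWeakDeriv f g) (h' : HasWeakDeriv f' g') : HasWeakDeriv (f + f') (g + g') := by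
  intro φ hφ
  simp only [Pi.add_apply, add_mul]
  rw [integral_add (hφ.integrable_mul_deriv hf) (hφ.integrable_mul_deriv hf'),
    integral_add (hφ.integrable_mul hg) (hφ.integrable_mul hg'), h φ hφ, h' φ hφ, neg_add]

theorem HasWeakDeriv.const_smul {f g : ℝ → ℝ} (r : ℝ) (h : HasWeakDeriv f g) :
    HasWeakDeriv (r • f) (r • g) := by
  intro φ hφ
  simp only [Pi.smul_apply, smul_eq_mul, mul_assoc, integral_const_mul]
  rw [h φ hφ, mul_neg]

theorem HasWeakDeriv.congr {f g f' g' : ℝ → ℝ} (h : HasWeakDeriv f g)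
    (hf : f =ᵐ[unitMeasure] f') (hg : g =ᵐ[unitMeasure] g') : HasWeakDeriv f' g' := by
  intro φ hφ
  have h1 : ∫ x in Ioo (0 : ℝ) 1, f x * deriv φ x = ∫ x in Ioo (0 : ℝ) 1, f' x * deriv φ x :=
    integral_congr_ae (hf.mul (ae_eq_refl (deriv φ)))
  have h2 : ∫ x in Ioo (0 : ℝ) 1, g x * φ x = ∫ x in Ioo (0 : ℝ) 1, g' x * φ x :=
    integral_congr_ae (hg.mul (ae_eq_refl φ))
  rw [← h1, ← h2]
  exact h φ hφ

theorem VanishesAtEnds.add {f g : ℝ → ℝ} (hf : VanishesAtEnds f) (hg : VanishesAtEnds g) :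
    VanishesAtEnds (f + g) := by
  obtain ⟨c, hc, hcf, h0, h1⟩ := hf
  obtain ⟨d, hd, hdg, k0, k1⟩ := hg
  exact ⟨c + d, hc.add hd, hcf.add hdg, by simp [h0, k0], by simp [h1, k1]⟩

theorem VanishesAtEnds.const_smul {f : ℝ → ℝ} (r : ℝ) (hf : VanishesAtEnds f) :
    VanishesAtEnds (r • f) := by
  obtain ⟨c, hc, hcf, h0, h1⟩ := hf
  exact ⟨r • c, hc.const_smul r, hcf.const_smul r, by simp [h0], by simp [h1]⟩

theorem VanishesAtEnds.congr {f g : ℝ → ℝ} (hf : VanishesAtEnds f) (h : f =ᵐ[unitMeasure] g) :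
    VanishesAtEnds g := by
  obtain ⟨c, hc, hcf, h0, h1⟩ := hf
  exact ⟨c, hc, hcf.trans h, h0, h1⟩

theorem IsH20.zero : IsH20 0 0 0 where
  memLp := MemLp.zero
  memLp_deriv := MemLp.zero
  memLp_deriv_deriv := MemLp.zero
  weakDeriv := fun φ _ => by simp
  weakDeriv_deriv := fun φ _ => by simp
  vanishes := ⟨0, continuousOn_const, ae_eq_refl _, rfl, rfl⟩
  vanishes_deriv := ⟨0, continuousOn_const, ae_eq_refl _, rfl, rfl⟩

theorem IsH20.add {f g h f' g' h' : ℝ → ℝ} (H : IsH20 f g h) (H' : IsH20 f' g' h') :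
    IsH20 (f + f') (g + g') (h + h') where
  memLp := H.memLp.add H'.memLp
  memLp_deriv := H.memLp_deriv.add H'.memLp_deriv
  memLp_deriv_deriv := H.memLp_deriv_deriv.add H'.memLp_deriv_deriv
  weakDeriv := H.weakDeriv.add H.memLp H.memLp_deriv H'.memLp H'.memLp_deriv H'.weakDeriv
  weakDeriv_deriv := H.weakDeriv_deriv.add H.memLp_deriv H.memLp_deriv_deriv
    H'.memLp_deriv H'.memLp_deriv_deriv H'.weakDeriv_deriv
  vanishes := H.vanishes.add H'.vanishes
  vanishes_deriv := H.vanishes_deriv.add H'.vanishes_deriv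

theorem IsH20.const_smul {f g h : ℝ → ℝ} (r : ℝ) (H : IsH20 f g h) :
    IsH20 (r • f) (r • g) (r • h) where
  memLp := H.memLp.const_smul r
  memLp_deriv := H.memLp_deriv.const_smul r
  memLp_deriv_deriv := H.memLp_deriv_deriv.const_smul r
  weakDeriv := H.weakDeriv.const_smul r
  weakDeriv_deriv := H.weakDeriv_deriv.const_smul r
  vanishes := H.vanishes.const_smul r
  vanishes_deriv := H.vanishes_deriv.const_smul r

theorem IsH20.congr {f g h g' h' : ℝ → ℝ} (H : IsH20 f g h)
    (hg : g =ᵐ[unitMeasure] g') (hh : h =ᵐ[unitMeasure] h') : IsH20 f g' h' where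
  memLp := H.memLp
  memLp_deriv := H.memLp_deriv.ae_eq hg
  memLp_deriv_deriv := H.memLp_deriv_deriv.ae_eq hh
  weakDeriv := H.weakDeriv.congr (ae_eq_refl f) hg
  weakDeriv_deriv := H.weakDeriv_deriv.congr hg hh
  vanishes := H.vanishes
  vanishes_deriv := H.vanishes_deriv.congr hg

/-- The space `H²_{1/a}(0,1) = L²_{1/a}(0,1) ∩ H²₀(0,1)`. An element is recorded as the triple
`(u, u', u'')` of the function and its weak derivatives, so that the norm is
`(∫₀¹ u² / a dx + ∫₀¹ (u')² dx + ∫₀¹ (u'')² dx)^{1/2}`. -/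
def H2w (a : ℝ → ℝ) : Submodule ℝ (WithLp 2 (L2w a × WithLp 2 (L2 × L2))) where
  carrier := {p | ∃ f : ℝ → ℝ, f =ᵐ[weightedMeasure a] p.fst ∧ IsH20 f p.snd.fst p.snd.snd}
  zero_mem' := ⟨0, (Lp.coeFn_zero _ _ _).symm,
    IsH20.zero.congr (Lp.coeFn_zero _ _ _).symm (Lp.coeFn_zero _ _ _).symm⟩
  add_mem' := by
    rintro p q ⟨f, hf, Hf⟩ ⟨g, hg, Hg⟩
    exact ⟨f + g, (hf.add hg).trans (Lp.coeFn_add _ _).symm,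
      (Hf.add Hg).congr (Lp.coeFn_add _ _).symm (Lp.coeFn_add _ _).symm⟩
  smul_mem' := by
    rintro r p ⟨f, hf, Hf⟩
    exact ⟨r • f, (hf.const_smul r).trans (Lp.coeFn_smul _ _).symm,
      (Hf.const_smul r).congr (Lp.coeFn_smul _ _).symm (Lp.coeFn_smul _ _).symm⟩

/-- `u ∈ H²_{1/a}(0,1)` regarded as an element of `L²_{1/a}(0,1)`. -/
def toL2w {a : ℝ → ℝ} (u : H2w a) : L2w a := u.1.fst

/-- The second derivative `u'' ∈ L²(0,1)` of `u ∈ H²_{1/a}(0,1)`. -/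
def secondDeriv {a : ℝ → ℝ} (u : H2w a) : L2 := u.1.snd.snd

/-- The energy space `H₀ = H²_{1/a}(0,1) × L²_{1/a}(0,1)` (only its topology is used). -/
abbrev H0 (a : ℝ → ℝ) : Type := H2w a × L2w a

/-- `u ∈ D(A)` and `A u = f`, where `A u = a u''''` and
`D(A) = {u ∈ H²_{1/a}(0,1) : a u'''' ∈ L²_{1/a}(0,1)}`: the distributional fourth derivative of
`u` on `(0,1)` is the function `f / a` with `f ∈ L²_{1/a}(0,1)`. -/
def IsAValue (a : ℝ → ℝ) (u : H2w a) (f : L2w a) : Prop :=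
  ∀ φ : ℝ → ℝ, IsTestFunction φ →
    ∫ x in Ioo (0 : ℝ) 1, secondDeriv u x * deriv (deriv φ) x = ∫ x in Ioo (0 : ℝ) 1, f x / a x * φ x

/-- `P = (u, v) ∈ D(𝒜) = D(A) × H²_{1/a}(0,1)` and `Q = 𝒜 P = (v, - A u)`. -/
def IsGeneratorValue (a : ℝ → ℝ) (P Q : H0 a) : Prop :=
  toL2w Q.1 = P.2 ∧ IsAValue a P.1 (-Q.2)

/-- `U` is a mild solution on `[0,∞)` of `U' = 𝒜 U`, `U(0) = U₀`: `U ∈ C([0,∞); H₀)` and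
`V(t) = ∫₀ᵗ U(s) ds` (the primitive of `U` vanishing at `0`) satisfies `V(t) ∈ D(𝒜)` and
`U(t) = U₀ + 𝒜 V(t)` for all `t ≥ 0`. -/
def IsMildCauchySolution (a : ℝ → ℝ) (U₀ : H0 a) (U : ℝ → H0 a) : Prop :=
  ContinuousOn U (Ici 0) ∧
    ∃ V : ℝ → H0 a, V 0 = 0 ∧ (∀ t : ℝ, 0 ≤ t → HasDerivWithinAt V (U t) (Ici 0) t) ∧
      ∀ t : ℝ, 0 ≤ t → IsGeneratorValue a (V t) (U t - U₀)

/-- The time derivative `y_t(t) ∈ L²_{1/a}(0,1)` of `y : [0,∞) → H²_{1/a}(0,1)` (one-sided at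
`t = 0`). -/
def timeDeriv {a : ℝ → ℝ} (y : ℝ → H2w a) (t : ℝ) : L2w a :=
  derivWithin (fun s => toL2w (y s)) (Ici 0) t

/-- `y` is a mild solution, with initial data `y(0) = y₀`, `y_t(0) = y₁`, of
`y_tt + a y_xxxx = 0` on `(0,∞) × (0,1)`, `y = y_x = 0` at `x = 0` and `x = 1`:
`y ∈ C¹([0,∞); L²_{1/a}(0,1)) ∩ C([0,∞); H²_{1/a}(0,1))` and `(y, y_t)` is a mild solution of the
first-order Cauchy problem. -/
structure IsMildSolution (a : ℝ → ℝ) (y₀ : H2w a) (y₁ : L2w a) (y : ℝ → H2w a) : Prop where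
  contDiffOn : ContDiffOn ℝ 1 (fun t => toL2w (y t)) (Ici 0)
  continuousOn : ContinuousOn y (Ici 0)
  mild : IsMildCauchySolution a (y₀, y₁) fun t => (y t, timeDeriv y t)

/-- The energy `E_y(t) = ½ ∫₀¹ (y_t² / a + y_xx²) dx`. -/
def energy {a : ℝ → ℝ} (y : ℝ → H2w a) (t : ℝ) : ℝ :=
  1 / 2 * ∫ x in Ioo (0 : ℝ) 1, ((timeDeriv y t x) ^ 2 / a x + (secondDeriv (y t) x) ^ 2)

end

end DegenerateBeam

/-!
Write `𝒜 (u, v) = (v, - A u)` and `E (u, v) = ∫₀¹ (v² / a + (u'')²) dx`, so that the energy of `y` is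
`E (y, y_t) / 2`. Along a mild solution `U` with primitive `V` one has `U t = U₀ + 𝒜 (V t)`. The
increment `D t = V (t + h) - V t` therefore satisfies `D' = U (t + h) - U t = 𝒜 D`: it is a
classical solution. As `𝒜` is skew-symmetric for the energy form, `E (D t)` does not depend on `t`
(`stateEnergy_increment_eq`). Since `h⁻¹ • D t → U t` as `h → 0⁺` and `E` is continuous and
quadratic, `E (U t)` is constant as well. No density of `D(𝒜)` and no semigroup theory enter.

Skew-symmetry is Green's formula `∫ u'' v'' = ∫ (A u) v / a` for `u ∈ D(A)` and `v ∈ H²_{1/a}`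
(`IsAValue.inner_secondDeriv`), which by definition of `A` is known only when `v` is a test
function. An element `v` of `H²₀` is the twofold primitive of `v''`, and `v''` is orthogonal to the
affine functions (`IsH20.eq_doublePrimitive`). The twofold primitive of `h ∈ L²` is bounded by
`‖h‖ x`, and `x² / a` is bounded on `(0,1)` because `K < 2`. Hence the twofold primitive is a bounded
operator from `L²` to `L²_{1/a}` (`doublePrimitiveL`), and the difference of the two sides of Green's
formula is a bounded functional of `h = v''` on all of `L²`. Its Riesz representative `g` is
orthogonal to all `φ''` with `φ` a test function, hence affine by two applications of the lemma of
du Bois-Reymond (`exists_ae_eq_affine`). So the functional vanishes at `v''`.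
-/

namespace DegenerateBeam

/-! ### Test functions -/

theorem IsTestFunction.eq_zero_of_notMem {φ : ℝ → ℝ} (hφ : IsTestFunction φ) {x : ℝ}
    (hx : x ∉ Ioo (0 : ℝ) 1) : φ x = 0 :=
  image_eq_zero_of_notMem_tsupport fun h => hx (hφ.support h)

theorem IsTestFunction.contDiff_one {φ : ℝ → ℝ} (hφ : IsTestFunction φ) : ContDiff ℝ 1 φ :=
  hφ.smooth.of_le (by simp)

theorem IsTestFunction.hasDerivAt {φ : ℝ → ℝ} (hφ : IsTestFunction φ) (x : ℝ) :
    HasDerivAt φ (deriv φ x) x :=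
  (hφ.contDiff_one.differentiable one_ne_zero x).hasDerivAt

theorem IsTestFunction.deriv {φ : ℝ → ℝ} (hφ : IsTestFunction φ) : IsTestFunction (deriv φ) where
  smooth := (contDiff_infty_iff_deriv.1 hφ.smooth).2
  compact := hφ.compact.deriv
  support := (tsupport_deriv_subset (𝕜 := ℝ)).trans hφ.support

theorem IsTestFunction.sub_const_mul {φ ψ : ℝ → ℝ} (hφ : IsTestFunction φ)
    (hψ : IsTestFunction ψ) (r : ℝ) : IsTestFunction (fun x => φ x - r * ψ x) where
  smooth := hφ.smooth.sub (contDiff_const.mul hψ.smooth)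
  compact := hφ.compact.sub hψ.compact.mul_left
  support := by
    refine (tsupport_sub _ _).trans (union_subset hφ.support ?_)
    exact (closure_mono (Function.support_mul_subset_right _ _)).trans hψ.support

theorem IsTestFunction.integrable {φ : ℝ → ℝ} (hφ : IsTestFunction φ) :
    Integrable φ unitMeasure :=
  (hφ.smooth.continuous.integrable_of_hasCompactSupport hφ.compact).restrict

theorem exists_isTestFunction_integral_eq_one :
    ∃ ρ : ℝ → ℝ, IsTestFunction ρ ∧ ∫ x in Ioo (0 : ℝ) 1, ρ x = 1 := by
  let b : ContDiffBump (1 / 2 : ℝ) := ⟨1 / 8, 1 / 4, by norm_num, by norm_num⟩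
  have hsupp : tsupport (b.normed volume) ⊆ Ioo 0 1 := by
    rw [b.tsupport_normed_eq, Real.closedBall_eq_Icc]
    intro x hx
    simp only [b, mem_Icc] at hx
    constructor <;> linarith [hx.1, hx.2]
  refine ⟨b.normed volume, ⟨b.contDiff_normed, b.hasCompactSupport_normed, hsupp⟩, ?_⟩
  rw [setIntegral_eq_integral_of_forall_compl_eq_zero, b.integral_normed]
  exact fun x hx => image_eq_zero_of_notMem_tsupport fun h => hx (hsupp h)

theorem setIntegral_Ioo_eq_intervalIntegral (f : ℝ → ℝ) :
    ∫ x in Ioo (0 : ℝ) 1, f x = ∫ x in (0 : ℝ)..1, f x := by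
  rw [intervalIntegral.integral_of_le zero_le_one, integral_Ioc_eq_integral_Ioo]

/-- A test function of mean zero is the derivative of a test function. -/
theorem IsTestFunction.exists_deriv_eq {ψ : ℝ → ℝ} (hψ : IsTestFunction ψ)
    (h0 : ∫ x in Ioo (0 : ℝ) 1, ψ x = 0) : ∃ φ, IsTestFunction φ ∧ _root_.deriv φ = ψ := by
  have hc := hψ.smooth.continuous
  have hd : ∀ x, HasDerivAt (fun x => ∫ s in (0 : ℝ)..x, ψ s) (ψ x) x := fun x =>
    hc.integral_hasStrictDerivAt 0 x |>.hasDerivAt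
  have hderiv : _root_.deriv (fun x => ∫ s in (0 : ℝ)..x, ψ s) = ψ := funext fun x => (hd x).deriv
  -- the support of `ψ` lies in a compact subinterval, outside of which the primitive vanishes
  obtain ⟨ε, hε, hsub⟩ : ∃ ε > 0, tsupport ψ ⊆ Icc ε (1 - ε) := by
    rcases (tsupport ψ).eq_empty_or_nonempty with he | hne
    · exact ⟨1, one_pos, by simp [he]⟩
    · obtain ⟨m, hm, hm'⟩ := hψ.compact.exists_isLeast hne
      obtain ⟨M, hM, hM'⟩ := hψ.compact.exists_isGreatest hne
      have h1 := hψ.support hm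
      have h2 := hψ.support hM
      refine ⟨min m (1 - M), lt_min h1.1 (by linarith [h2.2]), fun x hx => ⟨?_, ?_⟩⟩
      · exact (min_le_left _ _).trans (hm' hx)
      · have := hM' hx
        have := min_le_right m (1 - M)
        linarith
  have hz : ∀ x, x ∉ Icc ε (1 - ε) → ψ x = 0 := fun x hx =>
    image_eq_zero_of_notMem_tsupport fun h => hx (hsub h)
  have hsupp : ∀ x, x ∉ Icc ε (1 - ε) → ∫ s in (0 : ℝ)..x, ψ s = 0 := by
    intro x hx
    rcases lt_or_ge x ε with h | h
    · rw [intervalIntegral.integral_congr (g := fun _ => 0)]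
      · simp
      · intro s hs
        refine hz s fun hs' => ?_
        have := (mem_uIcc.1 hs)
        rcases this with h' | h' <;> linarith [h'.1, h'.2, hs'.1]
    · have hx1 : 1 - ε < x := by
        by_contra! h'
        exact hx ⟨h, h'⟩
      have h01 : ∫ s in (0 : ℝ)..1, ψ s = 0 := by
        rw [← setIntegral_Ioo_eq_intervalIntegral, h0]
      rw [← intervalIntegral.integral_add_adjacent_intervals (hc.intervalIntegrable 0 1)
        (hc.intervalIntegrable 1 x), h01, zero_add,
        intervalIntegral.integral_congr (g := fun _ => 0)]
      · simp
      · intro s hs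
        refine hz s fun hs' => ?_
        have := (mem_uIcc.1 hs)
        rcases this with h' | h' <;> linarith [h'.1, h'.2, hs'.2]
  have hts : tsupport (fun x => ∫ s in (0 : ℝ)..x, ψ s) ⊆ Icc ε (1 - ε) :=
    closure_minimal (fun x hx => by
      by_contra h
      exact hx (hsupp x h)) isClosed_Icc
  refine ⟨_, ⟨contDiff_infty_iff_deriv.2 ⟨fun x => (hd x).differentiableAt, ?_⟩, ?_, ?_⟩, hderiv⟩
  · rw [hderiv]; exact hψ.smooth
  · exact HasCompactSupport.of_support_subset_isCompact isCompact_Icc (subset_closure.trans hts)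
  · exact hts.trans fun x hx => ⟨by linarith [hx.1], by linarith [hx.2]⟩

/-! ### Weak derivatives on the unit interval -/

theorem memLp_const_unit (c : ℝ) : MemLp (fun _ => c) 2 unitMeasure := memLp_const c

/-- The fundamental lemma of the calculus of variations on `(0,1)`. -/
theorem ae_eq_zero_of_integral_mul_testFunction {f : ℝ → ℝ} (hf : MemLp f 2 unitMeasure)
    (h : ∀ φ, IsTestFunction φ → ∫ x in Ioo (0 : ℝ) 1, f x * φ x = 0) :
    f =ᵐ[unitMeasure] 0 := by
  have h1 : IntegrableOn f (Ioo 0 1) volume := hf.integrable one_le_two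
  have := isOpen_Ioo.ae_eq_zero_of_integral_contDiff_smul_eq_zero (U := Ioo (0 : ℝ) 1)
    h1.locallyIntegrableOn fun φ h1 h2 h3 => by
      have hφ : IsTestFunction φ := ⟨h1, h2, h3⟩
      rw [← h φ hφ, setIntegral_eq_integral_of_forall_compl_eq_zero]
      · simp [mul_comm]
      · intro x hx
        rw [hφ.eq_zero_of_notMem hx, mul_zero]
  exact (ae_restrict_iff' measurableSet_Ioo).2 this

/-- The lemma of du Bois-Reymond on `(0,1)`: a function whose weak derivative vanishes is
constant. -/
theorem HasWeakDeriv.exists_ae_eq_const {f : ℝ → ℝ} (hf : MemLp f 2 unitMeasure)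
    (h : HasWeakDeriv f 0) : ∃ c : ℝ, f =ᵐ[unitMeasure] fun _ => c := by
  obtain ⟨ρ, hρ, hρ1⟩ := exists_isTestFunction_integral_eq_one
  set c := ∫ x in Ioo (0 : ℝ) 1, f x * ρ x with hc
  refine ⟨c, ?_⟩
  have key := ae_eq_zero_of_integral_mul_testFunction (hf.sub (memLp_const_unit c)) fun ψ hψ => by
    -- `ψ` minus a multiple of `ρ` has mean zero, hence is a derivative
    set m := ∫ x in Ioo (0 : ℝ) 1, ψ x with hm
    obtain ⟨φ, hφ, hd⟩ := (hψ.sub_const_mul hρ m).exists_deriv_eq (by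
      rw [integral_sub hψ.integrable (hρ.integrable.const_mul m), integral_const_mul, hρ1]
      simp [hm])
    have h2 := h φ hφ
    simp only [hd, Pi.zero_apply, zero_mul, integral_zero, neg_zero] at h2
    have h3 : ∫ x in Ioo (0 : ℝ) 1, f x * (ψ x - m * ρ x)
        = (∫ x in Ioo (0 : ℝ) 1, f x * ψ x) - m * c := by
      rw [hc, ← integral_const_mul, ← integral_sub (hψ.integrable_mul hf)
        ((hρ.integrable_mul hf).const_mul m)]
      congr 1; ext x; ring
    have h4 : ∫ x in Ioo (0 : ℝ) 1, (f x - c) * ψ x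
        = (∫ x in Ioo (0 : ℝ) 1, f x * ψ x) - c * m := by
      rw [hm, ← integral_const_mul, ← integral_sub (hψ.integrable_mul hf)
        (hψ.integrable.const_mul c)]
      congr 1; ext x; ring
    simp only [Pi.sub_apply]
    rw [h4]
    linarith
  filter_upwards [key] with x hx
  simpa [sub_eq_zero] using hx


theorem memLp_of_continuousOn {f : ℝ → ℝ} (hf : ContinuousOn f (Icc 0 1)) :
    MemLp f 2 unitMeasure := by
  obtain ⟨C, hC⟩ := isCompact_Icc.exists_bound_of_continuousOn hf
  refine MemLp.of_bound ((hf.mono Ioo_subset_Icc_self).aestronglyMeasurable measurableSet_Ioo) C ?_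
  filter_upwards [ae_restrict_mem measurableSet_Ioo] with x hx
  exact hC x (Ioo_subset_Icc_self hx)

theorem intervalIntegrable_of_memLp {g : ℝ → ℝ} (hg : MemLp g 2 unitMeasure) :
    IntervalIntegrable g volume 0 1 := by
  rw [intervalIntegrable_iff_integrableOn_Ioo_of_le zero_le_one]
  exact hg.integrable one_le_two

theorem absolutelyContinuous_primitive {g : ℝ → ℝ} (hg : MemLp g 2 unitMeasure) :
    AbsolutelyContinuousOnInterval (fun x => ∫ s in (0 : ℝ)..x, g s) 0 1 :=
  (intervalIntegrable_of_memLp hg).absolutelyContinuousOnInterval_intervalIntegral (by simp)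

theorem continuousOn_primitive {g : ℝ → ℝ} (hg : MemLp g 2 unitMeasure) :
    ContinuousOn (fun x => ∫ s in (0 : ℝ)..x, g s) (Icc 0 1) := by
  simpa using (absolutelyContinuous_primitive hg).continuousOn

/-- Integration by parts for an absolutely continuous primitive. -/
theorem setIntegral_primitive_mul_deriv {g φ : ℝ → ℝ} (hg : MemLp g 2 unitMeasure)
    (hφ : ContDiff ℝ 1 φ) :
    ∫ x in Ioo (0 : ℝ) 1, (∫ s in (0 : ℝ)..x, g s) * deriv φ x
      = (∫ s in (0 : ℝ)..1, g s) * φ 1 - ∫ x in Ioo (0 : ℝ) 1, g x * φ x := by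
  rw [setIntegral_Ioo_eq_intervalIntegral,
    (absolutelyContinuous_primitive hg).integral_mul_deriv_eq_deriv_mul
      hφ.contDiffOn.absolutelyContinuousOnInterval, setIntegral_Ioo_eq_intervalIntegral]
  simp only [intervalIntegral.integral_same, zero_mul, sub_zero]
  congr 1
  refine intervalIntegral.integral_congr_ae ?_
  filter_upwards [(intervalIntegrable_of_memLp hg).ae_hasDerivAt_integral] with x hx hx'
  rw [(hx (uIoc_subset_uIcc hx') 0 (by simp)).deriv]

theorem hasWeakDeriv_primitive {g : ℝ → ℝ} (hg : MemLp g 2 unitMeasure) :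
    HasWeakDeriv (fun x => ∫ s in (0 : ℝ)..x, g s) g := by
  intro φ hφ
  rw [setIntegral_primitive_mul_deriv hg hφ.contDiff_one, hφ.eq_zero_of_notMem (x := 1) (by simp)]
  ring

/-- If the second distributional derivative of `g` vanishes, then `g` is affine. -/
theorem exists_ae_eq_affine {g : ℝ → ℝ} (hg : MemLp g 2 unitMeasure)
    (h : ∀ φ, IsTestFunction φ → ∫ x in Ioo (0 : ℝ) 1, g x * deriv (deriv φ) x = 0) :
    ∃ α β : ℝ, g =ᵐ[unitMeasure] fun x => α + β * x := by
  obtain ⟨ρ, hρ, hρ1⟩ := exists_isTestFunction_integral_eq_one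
  set k := ∫ x in Ioo (0 : ℝ) 1, g x * deriv ρ x with hk
  have hlin : (fun x => ∫ _ in (0 : ℝ)..x, k) = fun x => k * x := by
    ext x; simp [mul_comm]
  have hid : MemLp (fun x : ℝ => k * x) 2 unitMeasure :=
    memLp_of_continuousOn (by fun_prop)
  have hwk := hasWeakDeriv_primitive (memLp_const_unit k)
  rw [hlin] at hwk
  have hwg : HasWeakDeriv g (fun _ => -k) := by
    intro χ hχ
    -- `χ` minus a multiple of `ρ` has mean zero, hence is a derivative
    set m := ∫ x in Ioo (0 : ℝ) 1, χ x with hm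
    obtain ⟨φ, hφ, hd⟩ := (hχ.sub_const_mul hρ m).exists_deriv_eq (by
      rw [integral_sub hχ.integrable (hρ.integrable.const_mul m), integral_const_mul, hρ1]
      simp [hm])
    have h2 := h φ hφ
    have hd2 : deriv (deriv φ) = fun x => deriv χ x - m * deriv ρ x := by
      rw [hd]
      exact funext fun x => ((hχ.hasDerivAt x).sub ((hρ.hasDerivAt x).const_mul m)).deriv
    have h3 : ∫ x in Ioo (0 : ℝ) 1, g x * (deriv χ x - m * deriv ρ x)
        = (∫ x in Ioo (0 : ℝ) 1, g x * deriv χ x) - m * k := by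
      rw [hk, ← integral_const_mul, ← integral_sub (hχ.integrable_mul_deriv hg)
        ((hρ.integrable_mul_deriv hg).const_mul m)]
      congr 1; ext x; ring
    rw [integral_const_mul, ← hm]
    rw [hd2, h3] at h2
    linarith
  have key : HasWeakDeriv (g + fun x => k * x) 0 := by
    convert! hwg.add hg (memLp_const_unit (-k)) hid (memLp_const_unit k) hwk using 1
    ext x; simp
  obtain ⟨c, hc⟩ := key.exists_ae_eq_const (hg.add hid)
  refine ⟨c, -k, ?_⟩
  filter_upwards [hc] with x hx
  simp only [Pi.add_apply] at hx
  linarith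

/-- A weakly differentiable function vanishing at both ends is the primitive of its weak
derivative, which has mean zero. -/
theorem HasWeakDeriv.eq_primitive {f g : ℝ → ℝ} (hf : MemLp f 2 unitMeasure)
    (hg : MemLp g 2 unitMeasure) (h : HasWeakDeriv f g) (h0 : VanishesAtEnds f) :
    (f =ᵐ[unitMeasure] fun x => ∫ s in (0 : ℝ)..x, g s) ∧ ∫ s in (0 : ℝ)..1, g s = 0 := by
  have hJ := continuousOn_primitive hg
  have hJm := memLp_of_continuousOn hJ
  have key : HasWeakDeriv (f + (-1 : ℝ) • fun x => ∫ s in (0 : ℝ)..x, g s) 0 := by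
    convert! h.add hf hg (hJm.const_smul (-1)) (hg.const_smul (-1))
      ((hasWeakDeriv_primitive hg).const_smul (-1)) using 1
    simp
  obtain ⟨k, hk⟩ := key.exists_ae_eq_const (hf.add (hJm.const_smul (-1)))
  obtain ⟨c, hc, hcf, hc0, hc1⟩ := h0
  have hae : c =ᵐ[unitMeasure] fun x => k + ∫ s in (0 : ℝ)..x, g s := by
    filter_upwards [hcf, hk] with x h1 h2
    simp only [Pi.add_apply, Pi.smul_apply, smul_eq_mul] at h2
    linarith
  have hEq : EqOn c (fun x => k + ∫ s in (0 : ℝ)..x, g s) (Icc 0 1) := by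
    refine Measure.eqOn_Icc_of_ae_eq volume zero_ne_one ?_ hc (continuousOn_const.add hJ)
    rwa [← restrict_Ioo_eq_restrict_Icc]
  have hk0 : k = 0 := by
    have := hEq (left_mem_Icc.2 zero_le_one)
    simpa [hc0] using this.symm
  subst hk0
  constructor
  · filter_upwards [hcf, hae] with x h1 h2
    rw [← h1, h2, zero_add]
  · have := hEq (right_mem_Icc.2 zero_le_one)
    simpa [hc1] using this.symm

/-- The twofold primitive of `h` with zero value and slope at `0`. -/
noncomputable def doublePrimitive (h : ℝ → ℝ) (x : ℝ) : ℝ :=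
  ∫ s in (0 : ℝ)..x, ∫ r in (0 : ℝ)..s, h r

/-- A function of `H²₀(0,1)` is the twofold primitive of its second derivative `h`, and `h` is
orthogonal to the affine functions. -/
theorem IsH20.eq_doublePrimitive {f g h : ℝ → ℝ} (H : IsH20 f g h) :
    (f =ᵐ[unitMeasure] doublePrimitive h) ∧
      ∀ α β : ℝ, ∫ x in Ioo (0 : ℝ) 1, (α + β * x) * h x = 0 := by
  obtain ⟨hf, hg0⟩ := H.weakDeriv.eq_primitive H.memLp H.memLp_deriv H.vanishes
  obtain ⟨hg, hh0⟩ := H.weakDeriv_deriv.eq_primitive H.memLp_deriv H.memLp_deriv_deriv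
    H.vanishes_deriv
  constructor
  · filter_upwards [hf, ae_restrict_mem measurableSet_Ioo] with x hx hx01
    rw [hx, doublePrimitive]
    refine intervalIntegral.integral_congr_ae ?_
    filter_upwards [(ae_restrict_iff' measurableSet_Ioo).1 hg] with s hs hs'
    rw [uIoc_of_le hx01.1.le] at hs'
    exact hs ⟨hs'.1, hs'.2.trans_lt hx01.2⟩
  · intro α β
    have hd : deriv (fun x => α + β * x) = fun _ => β :=
      funext fun x => by simp
    have h1 := setIntegral_primitive_mul_deriv H.memLp_deriv_deriv
      (φ := fun x => α + β * x) (by fun_prop)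
    have h2 : ∫ x in Ioo (0 : ℝ) 1, (∫ s in (0 : ℝ)..x, h s) = 0 := by
      rw [← integral_congr_ae hg, setIntegral_Ioo_eq_intervalIntegral, hg0]
    rw [hd, integral_mul_const, h2, hh0] at h1
    simp only [mul_comm (h _)] at h1
    linarith

/-! ### The degenerate weight -/

section Weight

variable {a : ℝ → ℝ}

theorem IsDegenerateCoeff.aemeasurable_weight (ha : IsDegenerateCoeff a) :
    AEMeasurable (fun x => ENNReal.ofReal (1 / a x)) unitMeasure :=
  ((continuousOn_const.div (ha.continuousOn.mono Ioo_subset_Icc_self)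
    fun x hx => (ha.pos x (Ioo_subset_Ioc_self hx)).ne').aemeasurable
      measurableSet_Ioo).ennreal_ofReal

theorem weightedMeasure_absolutelyContinuous (a : ℝ → ℝ) : weightedMeasure a ≪ unitMeasure :=
  withDensity_absolutelyContinuous _ _

theorem IsDegenerateCoeff.integral_weightedMeasure (ha : IsDegenerateCoeff a) (f : ℝ → ℝ) :
    ∫ x, f x ∂weightedMeasure a = ∫ x in Ioo (0 : ℝ) 1, f x / a x := by
  rw [weightedMeasure, integral_withDensity_eq_integral_toReal_smul₀ ha.aemeasurable_weight
    (by simp)]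
  refine setIntegral_congr_fun measurableSet_Ioo fun x hx => ?_
  have := ha.pos x (Ioo_subset_Ioc_self hx)
  simp only [smul_eq_mul]
  rw [ENNReal.toReal_ofReal (by positivity)]
  ring

theorem IsDegenerateCoeff.integrable_weightedMeasure_iff (ha : IsDegenerateCoeff a) {f : ℝ → ℝ} :
    Integrable f (weightedMeasure a) ↔ Integrable (fun x => f x / a x) unitMeasure := by
  rw [weightedMeasure, integrable_withDensity_iff_integrable_smul₀' ha.aemeasurable_weight
    (by simp)]
  refine integrable_congr ?_
  filter_upwards [ae_restrict_mem measurableSet_Ioo] with x hx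
  have := ha.pos x (Ioo_subset_Ioc_self hx)
  simp only [smul_eq_mul]
  rw [ENNReal.toReal_ofReal (by positivity)]
  ring

/-- The degeneracy of `a` at `0` is at most quadratic: near `0`, `x ^ 2 / a x` is at most
`x ^ K / a x`, which is nondecreasing and hence bounded. -/
theorem IsDegenerateCoeff.exists_sq_div_le (ha : IsDegenerateCoeff a) :
    ∃ C : ℝ, ∀ x ∈ Ioo (0 : ℝ) 1, x ^ 2 / a x ≤ C := by
  obtain ⟨K, hK, δ, hδ, hmono⟩ := ha.mono
  have hcont : ContinuousOn (fun x => x ^ 2 / a x) (Icc δ 1) :=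
    (continuousOn_id.pow 2).div (ha.continuousOn.mono (Icc_subset_Icc_left hδ.1.le))
      fun x hx => (ha.pos x ⟨hδ.1.trans_le hx.1, hx.2⟩).ne'
  obtain ⟨C, hC⟩ := isCompact_Icc.exists_bound_of_continuousOn hcont
  refine ⟨max C (δ ^ K / a δ), fun x hx => ?_⟩
  rcases le_or_gt δ x with h | h
  · exact (le_abs_self _).trans ((hC x ⟨h, hx.2.le⟩).trans (le_max_left _ _))
  · have ha0 := ha.pos x (Ioo_subset_Ioc_self hx)
    have hpow : x ^ 2 ≤ x ^ K := by
      rw [← Real.rpow_natCast x 2]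
      exact Real.rpow_le_rpow_of_exponent_ge hx.1 hx.2.le (by push_cast; exact hK.2.le)
    have h1 : x ^ 2 / a x ≤ x ^ K / a x := by gcongr
    exact h1.trans ((hmono ⟨hx.1, h.le⟩ (right_mem_Ioc.2 hδ.1) h.le).trans (le_max_right _ _))

theorem IsDegenerateCoeff.memLp_id (ha : IsDegenerateCoeff a) :
    MemLp (fun x : ℝ => x) 2 (weightedMeasure a) := by
  rw [memLp_two_iff_integrable_sq measurable_id'.aestronglyMeasurable,
    ha.integrable_weightedMeasure_iff]
  obtain ⟨C, hC⟩ := ha.exists_sq_div_le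
  refine (integrable_const C).mono' ?_ ?_
  · refine ContinuousOn.aestronglyMeasurable ?_ measurableSet_Ioo
    exact (continuousOn_id.pow 2).div (ha.continuousOn.mono Ioo_subset_Icc_self)
      fun x hx => (ha.pos x (Ioo_subset_Ioc_self hx)).ne'
  · filter_upwards [ae_restrict_mem measurableSet_Ioo] with x hx
    have := ha.pos x (Ioo_subset_Ioc_self hx)
    rw [Real.norm_of_nonneg (by positivity)]
    exact hC x hx

end Weight

/-! ### The twofold primitive as an operator into the weighted space -/

theorem norm_primitive_le (h : L2) {s : ℝ} (hs : s ∈ Icc (0 : ℝ) 1) :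
    ‖∫ r in (0 : ℝ)..s, h r‖ ≤ ‖h‖ := by
  have hint : Integrable h unitMeasure := (Lp.memLp h).integrable one_le_two
  have h1 : ‖∫ r in (0 : ℝ)..s, h r‖ ≤ ∫ r in Ioo (0 : ℝ) 1, ‖h r‖ := by
    rw [intervalIntegral.integral_of_le hs.1, integral_Ioc_eq_integral_Ioo]
    refine (norm_integral_le_integral_norm _).trans ?_
    exact setIntegral_mono_set hint.norm (Filter.Eventually.of_forall fun _ => norm_nonneg _)
      (Ioo_subset_Ioo_right hs.2).eventuallyLE
  refine h1.trans ?_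
  rw [integral_norm_eq_lintegral_enorm hint.aestronglyMeasurable, ← eLpNorm_one_eq_lintegral_enorm,
    Lp.norm_def]
  refine ENNReal.toReal_mono (Lp.eLpNorm_ne_top h) ?_
  have : IsProbabilityMeasure unitMeasure := ⟨by simp⟩
  exact eLpNorm_le_eLpNorm_of_exponent_le one_le_two hint.aestronglyMeasurable

theorem norm_doublePrimitive_le (h : L2) {x : ℝ} (hx : x ∈ Icc (0 : ℝ) 1) :
    ‖doublePrimitive h x‖ ≤ ‖h‖ * ‖x‖ := by
  have := intervalIntegral.norm_integral_le_of_norm_le_const (a := 0) (b := x)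
    (f := fun s => ∫ r in (0 : ℝ)..s, h r) (C := ‖h‖) fun s hs => by
      rw [uIoc_of_le hx.1] at hs
      exact norm_primitive_le h ⟨hs.1.le, hs.2.trans hx.2⟩
  simpa [doublePrimitive] using this

theorem doublePrimitive_congr_ae {g h : ℝ → ℝ} (hgh : g =ᵐ[unitMeasure] h) {x : ℝ}
    (hx : x ∈ Icc (0 : ℝ) 1) : doublePrimitive g x = doublePrimitive h x := by
  refine intervalIntegral.integral_congr fun s hs => ?_
  rw [uIcc_of_le hx.1] at hs
  have h1 := ae_restrict_of_ae_restrict_of_subset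
    (show Ioo (0 : ℝ) s ⊆ Ioo 0 1 from Ioo_subset_Ioo_right (hs.2.trans hx.2)) hgh
  rw [intervalIntegral.integral_of_le hs.1, intervalIntegral.integral_of_le hs.1,
    integral_Ioc_eq_integral_Ioo, integral_Ioc_eq_integral_Ioo]
  exact integral_congr_ae h1

theorem intervalIntegrable_of_memLp_of_mem {g : ℝ → ℝ} (hg : MemLp g 2 unitMeasure) {x : ℝ}
    (hx : x ∈ Icc (0 : ℝ) 1) : IntervalIntegrable g volume 0 x :=
  (intervalIntegrable_of_memLp hg).mono_set
    (by simpa [uIcc_of_le, hx.1] using! Icc_subset_Icc_right hx.2)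

theorem memLp_primitive {g : ℝ → ℝ} (hg : MemLp g 2 unitMeasure) :
    MemLp (fun x => ∫ s in (0 : ℝ)..x, g s) 2 unitMeasure :=
  memLp_of_continuousOn (continuousOn_primitive hg)

theorem doublePrimitive_add {g h : ℝ → ℝ} (hg : MemLp g 2 unitMeasure)
    (hh : MemLp h 2 unitMeasure) {x : ℝ} (hx : x ∈ Icc (0 : ℝ) 1) :
    doublePrimitive (g + h) x = doublePrimitive g x + doublePrimitive h x := by
  rw [doublePrimitive, doublePrimitive, doublePrimitive, ← intervalIntegral.integral_add
    (intervalIntegrable_of_memLp_of_mem (memLp_primitive hg) hx)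
    (intervalIntegrable_of_memLp_of_mem (memLp_primitive hh) hx)]
  refine intervalIntegral.integral_congr fun s hs => ?_
  rw [uIcc_of_le hx.1] at hs
  have hs' : s ∈ Icc (0 : ℝ) 1 := ⟨hs.1, hs.2.trans hx.2⟩
  exact intervalIntegral.integral_add (intervalIntegrable_of_memLp_of_mem hg hs')
    (intervalIntegrable_of_memLp_of_mem hh hs')

theorem doublePrimitive_smul (r : ℝ) (h : ℝ → ℝ) (x : ℝ) :
    doublePrimitive (r • h) x = r * doublePrimitive h x := by
  simp [doublePrimitive, intervalIntegral.integral_const_mul]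

theorem IsTestFunction.doublePrimitive_deriv_deriv {φ : ℝ → ℝ} (hφ : IsTestFunction φ) (x : ℝ) :
    doublePrimitive (_root_.deriv (_root_.deriv φ)) x = φ x := by
  have h1 : ∀ {ψ : ℝ → ℝ}, IsTestFunction ψ → ∀ x, ∫ s in (0 : ℝ)..x, _root_.deriv ψ s = ψ x := by
    intro ψ hψ x
    rw [intervalIntegral.integral_deriv_eq_sub (fun y _ => (hψ.hasDerivAt y).differentiableAt)
      (hψ.deriv.smooth.continuous.intervalIntegrable _ _),
      hψ.eq_zero_of_notMem (x := 0) (by simp), sub_zero]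
  simp only [doublePrimitive, h1 hφ.deriv, h1 hφ]

section Operator

variable {a : ℝ → ℝ}

theorem ae_weightedMeasure_mem (a : ℝ → ℝ) : ∀ᵐ x ∂weightedMeasure a, x ∈ Ioo (0 : ℝ) 1 :=
  (weightedMeasure_absolutelyContinuous a).ae_le (ae_restrict_mem measurableSet_Ioo)

theorem IsDegenerateCoeff.memLp_doublePrimitive (ha : IsDegenerateCoeff a) (h : L2) :
    MemLp (doublePrimitive h) 2 (weightedMeasure a) := by
  refine ha.memLp_id.of_le_mul (c := ‖h‖) ?_ ?_
  · refine AEStronglyMeasurable.mono_ac (weightedMeasure_absolutelyContinuous a) ?_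
    exact (memLp_primitive (memLp_primitive (Lp.memLp h))).1
  · filter_upwards [ae_weightedMeasure_mem a] with x hx
    exact norm_doublePrimitive_le h (Ioo_subset_Icc_self hx)

/-- The twofold primitive as a bounded operator `L²(0,1) → L²_{1/a}(0,1)`; it is bounded because
it is dominated by `x ↦ ‖h‖ x`, which lies in `L²_{1/a}(0,1)`. -/
noncomputable def doublePrimitiveL (ha : IsDegenerateCoeff a) : L2 →L[ℝ] L2w a :=
  LinearMap.mkContinuous
    { toFun := fun h => (ha.memLp_doublePrimitive h).toLp _
      map_add' := fun g h => by
        rw [← MemLp.toLp_add]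
        refine MemLp.toLp_congr _ _ ?_
        filter_upwards [ae_weightedMeasure_mem a] with x hx
        have hx' := Ioo_subset_Icc_self hx
        rw [doublePrimitive_congr_ae (Lp.coeFn_add g h) hx', Pi.add_apply,
          doublePrimitive_add (Lp.memLp g) (Lp.memLp h) hx']
      map_smul' := fun r h => by
        rw [RingHom.id_apply, ← MemLp.toLp_const_smul]
        refine MemLp.toLp_congr _ _ ?_
        filter_upwards [ae_weightedMeasure_mem a] with x hx
        rw [doublePrimitive_congr_ae (Lp.coeFn_smul r h) (Ioo_subset_Icc_self hx),
          doublePrimitive_smul, Pi.smul_apply, smul_eq_mul] }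
    ‖ha.memLp_id.toLp _‖ fun h => by
      rw [mul_comm]
      refine Lp.norm_le_mul_norm_of_ae_le_mul ?_
      filter_upwards [ae_weightedMeasure_mem a, (ha.memLp_doublePrimitive h).coeFn_toLp,
        ha.memLp_id.coeFn_toLp] with x hx h1 h2
      simp only [LinearMap.coe_mk, AddHom.coe_mk]
      rw [h1, h2]
      exact norm_doublePrimitive_le h (Ioo_subset_Icc_self hx)

theorem coeFn_doublePrimitiveL (ha : IsDegenerateCoeff a) (h : L2) :
    doublePrimitiveL ha h =ᵐ[weightedMeasure a] doublePrimitive h :=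
  (ha.memLp_doublePrimitive h).coeFn_toLp

theorem doublePrimitiveL_secondDeriv (ha : IsDegenerateCoeff a) (u : H2w a) :
    doublePrimitiveL ha (secondDeriv u) = toL2w u := by
  obtain ⟨f, hf, H⟩ := u.2
  refine Lp.ext ?_
  filter_upwards [coeFn_doublePrimitiveL ha (secondDeriv u), hf,
    (weightedMeasure_absolutelyContinuous a).ae_le H.eq_doublePrimitive.1] with x h1 h2 h3
  rw [h1, toL2w, ← h2, h3, secondDeriv]

/-- Green's formula: for `u ∈ D(A)` the identity `∫ u'' φ'' = ∫ (A u) φ / a` extends from test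
functions to all `v ∈ H²_{1/a}(0,1)`. The defect is a bounded functional of `v''`, represented by
some `g ∈ L²(0,1)` with `g'' = 0`; so `g` is affine, and `v''` is orthogonal to it. -/
theorem IsAValue.inner_secondDeriv (ha : IsDegenerateCoeff a) {u : H2w a} {f : L2w a}
    (hu : IsAValue a u f) (v : H2w a) :
    inner ℝ (secondDeriv u) (secondDeriv v) = inner ℝ f (toL2w v) := by
  let F : L2 →L[ℝ] ℝ := innerSL ℝ (secondDeriv u) - (innerSL ℝ f).comp (doublePrimitiveL ha)
  have hF : ∀ h, F h = inner ℝ (secondDeriv u) h - inner ℝ f (doublePrimitiveL ha h) :=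
    fun h => rfl
  set g : L2 := (InnerProductSpace.toDual ℝ L2).symm F with hg
  have hgF : ∀ h, inner ℝ g h = F h := fun h => InnerProductSpace.toDual_symm_apply
  obtain ⟨α, β, hαβ⟩ := exists_ae_eq_affine (Lp.memLp g) fun φ hφ => by
    have hm : MemLp (deriv (deriv φ)) 2 unitMeasure :=
      memLp_of_continuousOn hφ.deriv.deriv.smooth.continuous.continuousOn
    have h1 : ∀ w : L2, inner ℝ w (hm.toLp _) = ∫ x in Ioo (0 : ℝ) 1, w x * deriv (deriv φ) x := by
      intro w
      rw [L2.inner_def]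
      refine integral_congr_ae ?_
      filter_upwards [hm.coeFn_toLp] with x hx
      rw [hx]
      simp [mul_comm]
    have h2 : inner ℝ f (doublePrimitiveL ha (hm.toLp _))
        = ∫ x in Ioo (0 : ℝ) 1, f x / a x * φ x := by
      rw [L2.inner_def]
      have : ∫ x, inner ℝ (f x) (doublePrimitiveL ha (hm.toLp _) x) ∂weightedMeasure a
          = ∫ x, f x * φ x ∂weightedMeasure a := by
        refine integral_congr_ae ?_
        filter_upwards [coeFn_doublePrimitiveL ha (hm.toLp _), ae_weightedMeasure_mem a]
          with x hx hx01
        rw [hx, doublePrimitive_congr_ae hm.coeFn_toLp (Ioo_subset_Icc_self hx01),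
          hφ.doublePrimitive_deriv_deriv]
        simp [mul_comm]
      rw [this, ha.integral_weightedMeasure]
      congr 1; ext x; ring
    rw [← h1, hgF, hF, h1, h2, hu φ hφ, sub_self]
  have h0 : F (secondDeriv v) = 0 := by
    obtain ⟨w, -, H⟩ := v.2
    rw [← hgF, L2.inner_def, ← H.eq_doublePrimitive.2 α β]
    refine integral_congr_ae ?_
    filter_upwards [hαβ] with x hx
    rw [hx]
    simp [secondDeriv, mul_comm]
  rwa [hF, doublePrimitiveL_secondDeriv, sub_eq_zero] at h0

end Operator

/-! ### Conservation of energy -/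

section Energy

open Filter Topology

variable {a : ℝ → ℝ}

/-- `secondDeriv` as a bounded operator. -/
noncomputable def secondDerivL (a : ℝ → ℝ) : H2w a →L[ℝ] L2 :=
  ((WithLp.sndL 2 ℝ L2 L2).comp (WithLp.sndL 2 ℝ (L2w a) (WithLp 2 (L2 × L2)))).comp
    (H2w a).subtypeL

theorem secondDerivL_apply (u : H2w a) : secondDerivL a u = secondDeriv u := rfl

theorem toL2w_sub (u v : H2w a) : toL2w (u - v) = toL2w u - toL2w v := rfl

/-- Twice the energy of a state `P = (u, v)`, that is `∫₀¹ (v² / a + (u'')²) dx`. -/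
noncomputable def stateEnergy (P : H0 a) : ℝ := ‖P.2‖ ^ 2 + ‖secondDerivL a P.1‖ ^ 2

theorem continuous_stateEnergy : Continuous (stateEnergy (a := a)) := by
  unfold stateEnergy
  fun_prop

theorem stateEnergy_smul (r : ℝ) (P : H0 a) : stateEnergy (r • P) = r ^ 2 * stateEnergy P := by
  have h1 : (r • P).1 = r • P.1 := rfl
  have h2 : (r • P).2 = r • P.2 := rfl
  rw [stateEnergy, stateEnergy, h1, h2, map_smul, norm_smul, norm_smul, mul_pow, mul_pow,
    Real.norm_eq_abs, sq_abs]
  ring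

theorem energy_eq_stateEnergy (ha : IsDegenerateCoeff a) (y : ℝ → H2w a) (t : ℝ) :
    energy y t = 1 / 2 * stateEnergy (y t, timeDeriv y t) := by
  have h1 : ‖timeDeriv y t‖ ^ 2 = ∫ x in Ioo (0 : ℝ) 1, (timeDeriv y t x) ^ 2 / a x := by
    rw [← real_inner_self_eq_norm_sq, L2.inner_def, ← ha.integral_weightedMeasure]
    simp [sq]
  have h2 : ‖secondDeriv (y t)‖ ^ 2 = ∫ x in Ioo (0 : ℝ) 1, (secondDeriv (y t) x) ^ 2 := by
    rw [← real_inner_self_eq_norm_sq, L2.inner_def]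
    simp [sq]
  have i1 : Integrable (fun x => (timeDeriv y t x) ^ 2 / a x) unitMeasure :=
    ha.integrable_weightedMeasure_iff.1 (Lp.memLp (timeDeriv y t)).integrable_sq
  rw [energy, stateEnergy, secondDerivL_apply, h1, h2,
    integral_add i1 (Lp.memLp (secondDeriv (y t))).integrable_sq]

/-- The increment `P - P'` of two states and the increment `Q - Q'` of their images under the
affine map `P ↦ 𝒜 P + U₀` are orthogonal for the energy form: `𝒜` is skew-symmetric. -/
theorem IsGeneratorValue.inner_sub_eq_zero (ha : IsDegenerateCoeff a) {P Q P' Q' U₀ : H0 a}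
    (h : IsGeneratorValue a P (Q - U₀)) (h' : IsGeneratorValue a P' (Q' - U₀)) :
    inner ℝ (P - P').2 (Q - Q').2
      + inner ℝ (secondDerivL a (P - P').1) (secondDerivL a (Q - Q').1) = 0 := by
  have e : toL2w (Q - Q').1 = (P - P').2 := by
    have e1 := h.1
    have e2 := h'.1
    simp only [Prod.fst_sub, Prod.snd_sub, toL2w_sub] at e1 e2 ⊢
    rw [← e1, ← e2]
    abel
  have g := h.2.inner_secondDeriv ha (Q - Q').1
  have g' := h'.2.inner_secondDeriv ha (Q - Q').1
  rw [e] at g g'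
  rw [Prod.fst_sub P P', map_sub, inner_sub_left]
  simp only [secondDerivL_apply]
  rw [g, g', ← inner_sub_left, real_inner_comm, ← inner_add_left]
  convert! inner_zero_left (𝕜 := ℝ) _ using 2
  simp only [Prod.snd_sub]
  abel

/-- If `V' = U` and `V` is carried to `U - U₀` by the generator, then the increments
`t ↦ V (t + h) - V t` have constant energy. -/
theorem stateEnergy_increment_eq (ha : IsDegenerateCoeff a) {U V : ℝ → H0 a} {U₀ : H0 a}
    (hV : ∀ t, 0 ≤ t → HasDerivWithinAt V (U t) (Ici 0) t)
    (hA : ∀ t, 0 ≤ t → IsGeneratorValue a (V t) (U t - U₀)) {h t : ℝ} (hh : 0 ≤ h) (ht : 0 ≤ t) :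
    stateEnergy (V (t + h) - V t) = stateEnergy (V (0 + h) - V 0) := by
  have hD : ∀ s, 0 ≤ s →
      HasDerivWithinAt (fun s => V (s + h) - V s) (U (s + h) - U s) (Ici 0) s := by
    intro s hs
    refine HasDerivWithinAt.sub ?_ (hV s hs)
    have := (hV (s + h) (add_nonneg hs hh)).scomp s
      (((hasDerivAt_id s).add_const h).hasDerivWithinAt (s := Ici 0))
      fun x (hx : 0 ≤ x) => add_nonneg hx hh
    simpa [Function.comp_def] using this
  have hE : ∀ s, 0 ≤ s →
      HasDerivWithinAt (fun s => stateEnergy (V (s + h) - V s)) 0 (Ici 0) s := by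
    intro s hs
    have d2 := ((ContinuousLinearMap.snd ℝ (H2w a) (L2w a)).hasFDerivAt
      |>.comp_hasDerivWithinAt s (hD s hs)).norm_sq
    have d1 := (((secondDerivL a).comp (ContinuousLinearMap.fst ℝ (H2w a) (L2w a))).hasFDerivAt
      |>.comp_hasDerivWithinAt s (hD s hs)).norm_sq
    convert! d2.add d1 using 1
    have := (hA (s + h) (add_nonneg hs hh)).inner_sub_eq_zero ha (hA s hs)
    simp only [Function.comp_apply, ContinuousLinearMap.coe_snd', ContinuousLinearMap.coe_comp,
      ContinuousLinearMap.coe_fst']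
    linarith
  exact constant_of_has_deriv_right_zero
    (fun s hs => ((hE s hs.1).continuousWithinAt).mono Icc_subset_Ici_self)
    (fun s hs => (hE s hs.1).mono (Ici_subset_Ici.2 hs.1)) t (right_mem_Icc.2 ht)

/-- The energies of the increments of `V`, divided by `h ^ 2`, recover the energy of `V' = U`. -/
theorem tendsto_stateEnergy_slope {U V : ℝ → H0 a} {t : ℝ} (ht : 0 ≤ t)
    (hV : HasDerivWithinAt V (U t) (Ici 0) t) :
    Tendsto (fun h => (h⁻¹) ^ 2 * stateEnergy (V (t + h) - V t)) (𝓝[>] 0)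
      (𝓝 (stateEnergy (U t))) := by
  have h1 : HasDerivWithinAt V (U t) (Ioi t) t :=
    hV.mono fun s (hs : t < s) => ht.trans hs.le
  rw [hasDerivWithinAt_iff_tendsto_slope' (by simp)] at h1
  have h2 : Tendsto (fun h : ℝ => t + h) (𝓝[>] 0) (𝓝[>] t) := by
    refine tendsto_nhdsWithin_iff.2 ⟨?_, ?_⟩
    · refine Tendsto.mono_left ?_ nhdsWithin_le_nhds
      simpa using (continuous_const_add t).tendsto (0 : ℝ)
    · filter_upwards [self_mem_nhdsWithin] with h hh
      simpa using hh
  refine ((continuous_stateEnergy.tendsto _).comp (h1.comp h2)).congr fun h => ?_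
  simp only [Function.comp_apply, slope_def_module, add_sub_cancel_left, stateEnergy_smul]

/-- The energy is constant along mild solutions of the first-order Cauchy problem. -/
theorem IsMildCauchySolution.stateEnergy_eq (ha : IsDegenerateCoeff a) {U₀ : H0 a}
    {U : ℝ → H0 a} (hU : IsMildCauchySolution a U₀ U) {t : ℝ} (ht : 0 ≤ t) :
    stateEnergy (U t) = stateEnergy (U 0) := by
  obtain ⟨-, V, -, hV, hA⟩ := hU
  refine tendsto_nhds_unique (tendsto_stateEnergy_slope ht (hV t ht)) ?_
  refine (tendsto_stateEnergy_slope le_rfl (hV 0 le_rfl)).congr' ?_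
  filter_upwards [self_mem_nhdsWithin] with h hh
  rw [stateEnergy_increment_eq ha hV hA (le_of_lt hh) ht]

end Energy

end DegenerateBeam

theorem mainTheorem7 (a : ℝ → ℝ) (ha : DegenerateBeam.IsDegenerateCoeff a)
    (y₀ : DegenerateBeam.H2w a) (y₁ : DegenerateBeam.L2w a) (y : ℝ → DegenerateBeam.H2w a)
    (hy : DegenerateBeam.IsMildSolution a y₀ y₁ y) :
    ∀ t : ℝ, 0 ≤ t → DegenerateBeam.energy y t = DegenerateBeam.energy y 0 := by
  intro t ht
  rw [DegenerateBeam.energy_eq_stateEnergy ha, DegenerateBeam.energy_eq_stateEnergy ha,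
    hy.mild.stateEnergy_eq ha ht]
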